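/- Let $\mathcal M$ be a von Neumann algebra acting on a Hilbert space, with a trace $\tau$, that is, a faithful normal tracial positive linear functional $\tau:\mathcal M\to\mathbb C$. Let $L^1(\mathcal M)$ be the noncommutative $L^1$-space of $(\mathcal M,\tau)$, identified with the predual of $\mathcal M$ (the normal linear functionals) by $h\mapsto\tau(h\,\cdot)$, and let $\|x\|_1=\tau(|x|)$. Let $k>0$. A good $k$-comultiplication is a normal linear map $\Delta:\mathcal M\to\mathcal M\overline\otimes\mathcal M$ of norm $k$ that is positive and satisfies $\Delta(I)=kI$. It induces a bilinear map $\ast:\mathcal M\times\mathcal M\to L^1(\mathcal M)$ by $\tau((x\ast y)z^*)=(\tau\otimes\tau)\big((x\otimes y)\Delta(z)^*\big)$ for all $x,y,z\in\mathcal M$. A good $k$-convolution is a bilinear map $\ast:\mathcal M\times\mathcal M\to L^1(\mathcal M)$ that is induced by a good $k$-comultiplication or, more generally, has the following three properties: $x\ast y\ge 0$ for all $x,y\geq 0$ in $\mathcal M$; $\|x\ast y\|_1\le k\|x\|_1\|y\|_1$ for all $x,y\in\mathcal M$; and $\tau(x\ast y)=k\,\tau(x)\tau(y)$ for all $x,y\in\mathcal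 M$. A Frobenius von Neumann $k$-algebra (FN $k$-algebra) is a quadruple $(\mathcal M,\tau,\ast,\rho)$, where $\ast$ is a good $k$-convolution and $\rho:\mathcal M\to\mathcal M$ is a trace-preserving anti-$*$-isomorphism satisfying the Frobenius reciprocity $\tau((x\ast y)z)=\tau((\rho(z)\ast x)\rho(y))$ for all $x,y,z\in\mathcal M$. For $x\in\mathcal M$, let $\mathcal R(x)\in\mathcal M$ be the range projection of $x$, that is, the projection onto the closure of the range of $x$; for $h\in L^1(\mathcal M)$, let $\mathcal R(h)$ be its range projection, that is, the smallest projection $e\in\mathcal M$ with $eh=h$. Put $\mathcal S=\tau\circ\mathcal R$. **Theorem.** Let $(\mathcal M,\tau,\ast,\rho)$ be an FN $k$-algebra. For all nonzero $x,y\in\mathcal M$, $$\mathcal S\big(\mathcal R(x)\ast\mathcal R(y)\big)\ \ge\ \max\{\mathcal S(x),\mathcal S(y)\}.$$ -/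

import Mathlib

open scoped TensorProduct ComplexOrder InnerProductSpace

universe u

noncomputable section

namespace FNAlg

/-! ### Von Neumann algebras, positivity, normality -/

section Basic

variable {H : Type u} [NormedAddCommGroup H] [InnerProductSpace ℂ H] [CompleteSpace H]

/-- The elements of a concrete von Neumann algebra `M` acting on `H`. -/
abbrev Elem (M : VonNeumannAlgebra H) : Type u := ↥M.toStarSubalgebra

variable {M : VonNeumannAlgebra H}

theorem mem_of_commutes {a : H →L[ℂ] H} (h : ∀ y ∈ M.commutant, y * a = a * y) :
    a ∈ M.toStarSubalgebra := by
  have : a ∈ M.commutant.commutant := VonNeumannAlgebra.mem_commutant_iff.2 h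
  rw [VonNeumannAlgebra.commutant_commutant] at this
  exact this

theorem commutes_of_mem (x : Elem M) {y : H →L[ℂ] H} (hy : y ∈ M.commutant) :
    y * x.1 = x.1 * y :=
  (VonNeumannAlgebra.mem_commutant_iff.1 hy x.1 x.2).symm

/-- `x ≥ 0`, as an operator on the Hilbert space. -/
def IsPos (x : Elem M) : Prop := (x : H →L[ℂ] H).IsPositive

/-- `e` is a projection of `M` (`e = e* = e²`). -/
def IsProj (e : Elem M) : Prop := IsStarProjection (e : H →L[ℂ] H)

/-- A linear functional on `M` is normal (`σ`-weakly continuous) when it is of the form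
`x ↦ ∑ₙ ⟪ηₙ, x ξₙ⟫` with `∑ₙ ‖ξₙ‖² < ∞` and `∑ₙ ‖ηₙ‖² < ∞`. -/
def IsNormal (φ : Elem M →ₗ[ℂ] ℂ) : Prop :=
  ∃ ξ η : ℕ → H, Summable (fun n => ‖ξ n‖ ^ 2) ∧ Summable (fun n => ‖η n‖ ^ 2) ∧
    ∀ x : Elem M, HasSum (fun n => ⟪η n, (x : H →L[ℂ] H) (ξ n)⟫_ℂ) (φ x)

/-- A trace on `M`: a faithful normal tracial positive linear functional. -/
structure IsTrace (τ : Elem M →ₗ[ℂ] ℂ) : Prop where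
  nonneg : ∀ x : Elem M, IsPos x → 0 ≤ τ x
  faithful : ∀ x : Elem M, IsPos x → τ x = 0 → x = 0
  tracial : ∀ x y : Elem M, τ (x * y) = τ (y * x)
  normal : IsNormal τ

/-! ### The space `L¹(M)` -/

theorem isNormal_zero : IsNormal (0 : Elem M →ₗ[ℂ] ℂ) :=
  ⟨fun _ => 0, fun _ => 0, by simp, by simp, fun x => by simp⟩

theorem IsNormal.smul {φ : Elem M →ₗ[ℂ] ℂ} (h : IsNormal φ) (c : ℂ) : IsNormal (c • φ) := by
  obtain ⟨ξ, η, h1, h2, h3⟩ := h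
  refine ⟨fun n => c • ξ n, η, ?_, h2, fun x => ?_⟩
  · simpa only [norm_smul, mul_pow] using h1.mul_left (‖c‖ ^ 2)
  · simpa [inner_smul_right] using (h3 x).mul_left c

theorem IsNormal.add {φ ψ : Elem M →ₗ[ℂ] ℂ} (hφ : IsNormal φ) (hψ : IsNormal ψ) :
    IsNormal (φ + ψ) := by
  obtain ⟨ξ, η, h1, h2, h3⟩ := hφ
  obtain ⟨ξ', η', h1', h2', h3'⟩ := hψ
  let e : ℕ ≃ ℕ ⊕ ℕ := Equiv.natSumNatEquivNat.symm
  refine ⟨fun n => Sum.elim ξ ξ' (e n), fun n => Sum.elim η η' (e n), ?_, ?_, fun x => ?_⟩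
  · exact (e.summable_iff (f := fun s => ‖Sum.elim ξ ξ' s‖ ^ 2)).2
      (Summable.sum _ (by simpa [Function.comp_def] using h1)
        (by simpa [Function.comp_def] using h1'))
  · exact (e.summable_iff (f := fun s => ‖Sum.elim η η' s‖ ^ 2)).2
      (Summable.sum _ (by simpa [Function.comp_def] using h2)
        (by simpa [Function.comp_def] using h2'))
  · exact (e.hasSum_iff
      (f := fun s => ⟪Sum.elim η η' s, (x : H →L[ℂ] H) (Sum.elim ξ ξ' s)⟫_ℂ)).2
      (HasSum.sum (by simpa [Function.comp_def] using h3 x)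
        (by simpa [Function.comp_def] using h3' x))

/-- `L¹(M)`, realized as the predual of `M` (the normal linear functionals): for a trace `τ`, an
operator `h ∈ L¹(M, τ)` is identified with the functional `z ↦ τ (h z)`; this is the standard
isometric isomorphism `L¹(M, τ) ≅ M_*`, and `h ≥ 0` corresponds to positivity of the
functional. -/
def L1 (M : VonNeumannAlgebra H) : Submodule ℂ (Elem M →ₗ[ℂ] ℂ) where
  carrier := {φ | IsNormal φ}
  add_mem' := IsNormal.add
  zero_mem' := isNormal_zero
  smul_mem' c _ h := IsNormal.smul h c

/-- The inclusion `M ⊆ L¹(M)`, `x ↦ τ (x ·)`. -/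
def toL1 (τ : L1 M) (x : Elem M) : L1 M :=
  ⟨τ.1 ∘ₗ LinearMap.mulLeft ℂ x, by
    obtain ⟨ξ, η, h1, h2, h3⟩ := τ.2
    refine ⟨ξ, fun n => (star x : Elem M).1 (η n), h1, ?_, fun z => ?_⟩
    · refine Summable.of_nonneg_of_le (fun n => by positivity) (fun n => ?_)
        (h2.mul_left (‖(star x : Elem M).1‖ ^ 2))
      rw [← mul_pow]
      gcongr
      exact ContinuousLinearMap.le_opNorm _ _
    · have := h3 (x * z)
      simpa [ContinuousLinearMap.star_eq_adjoint, ContinuousLinearMap.adjoint_inner_left]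
        using this⟩

/-- An element of `L¹(M)` is positive. -/
def L1IsPos (φ : L1 M) : Prop := ∀ z : Elem M, IsPos z → 0 ≤ φ.1 z

/-- The value of the trace on an element of `L¹(M)`: `τ (h) = τ (h 1)`. -/
def L1trace (φ : L1 M) : ℂ := φ.1 1

/-! ### Absolute value and the `1`-norm -/

/-- `|x| = (x* x)^{1/2}`, as an element of `M`. -/
def absElem (x : Elem M) : Elem M :=
  ⟨CFC.abs (x : H →L[ℂ] H), mem_of_commutes fun y hy => by
    have h : Commute (star x.1 * x.1) y := by
      have := commutes_of_mem (star x * x) hy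
      exact this.symm
    unfold CFC.abs CFC.sqrt
    exact (Commute.cfcₙ_nnreal h NNReal.sqrt).symm.eq⟩

/-- `‖x‖₁ = τ (|x|)`. -/
def norm1 (τ : Elem M →ₗ[ℂ] ℂ) (x : Elem M) : ℝ := (τ (absElem x)).re

/-! ### Range projections -/

/-- The orthogonal projection onto a closed subspace that is invariant under the commutant. -/
def projOnto (K : Submodule ℂ H) [K.HasOrthogonalProjection]
    (hK : ∀ y ∈ M.commutant, ∀ v ∈ K, y v ∈ K) : Elem M :=
  ⟨K.starProjection, by
    have h := (VonNeumannAlgebra.IsStarProjection.mem_iff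
      (isStarProjection_starProjection (U := K)) M).2 (fun y hy => by
        rw [Module.End.mem_invtSubmodule]
        intro v hv
        rw [Submodule.range_starProjection] at hv ⊢
        exact hK y hy v hv)
    exact h⟩

/-- The range projection `R(x)` of `x ∈ M`: the orthogonal projection onto the closure of the
range of `x`. -/
def rangeProj (x : Elem M) : Elem M :=
  projOnto (x : H →L[ℂ] H).range.topologicalClosure fun y hy v hv => by
    have hmap : Set.MapsTo y ((x : H →L[ℂ] H).range : Set H) ((x : H →L[ℂ] H).range : Set H) := by
      rintro _ ⟨w, rfl⟩
      exact ⟨y w, (congrArg (fun T : H →L[ℂ] H => T w) (commutes_of_mem x hy)).symm⟩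
    exact hmap.closure y.continuous hv

/-- The projections `e ∈ M` with `e h = h`, where `h ∈ L¹(M)` is given by the functional
`φ = τ (h ·)`; the condition reads `τ (h z e) = τ (h z)` for all `z ∈ M`. -/
def leftUnits (φ : L1 M) : Set (Elem M) :=
  {e | IsProj e ∧ ∀ z : Elem M, φ.1 (z * e) = φ.1 z}

/-- The intersection of the ranges of the projections `e ∈ M` with `e h = h`. -/
def L1range (φ : L1 M) : Submodule ℂ H :=
  ⨅ e ∈ leftUnits φ, (e : H →L[ℂ] H).range

theorem isProj_apply {e : Elem M} (he : IsProj e) {v : H} :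
    v ∈ (e : H →L[ℂ] H).range ↔ (e : H →L[ℂ] H) v = v := by
  constructor
  · rintro ⟨w, rfl⟩
    exact congrArg (fun T : H →L[ℂ] H => T w) he.isIdempotentElem.eq
  · exact fun h => ⟨v, h⟩

theorem isClosed_L1range (φ : L1 M) : IsClosed (L1range φ : Set H) := by
  have : (L1range φ : Set H) =
      ⋂ e ∈ leftUnits φ, {v : H | (e : H →L[ℂ] H) v = v} := by
    ext v
    simp only [L1range, SetLike.mem_coe, Submodule.mem_iInf, Set.mem_iInter, Set.mem_ofPred_eq]
    exact forall₂_congr fun e he => isProj_apply he.1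
  rw [this]
  exact isClosed_biInter fun e _ => isClosed_eq (e : H →L[ℂ] H).continuous continuous_id

instance (φ : L1 M) : CompleteSpace (L1range φ) :=
  (isClosed_L1range φ).completeSpace_coe

/-- The range projection `R(h)` of `h ∈ L¹(M)`: the smallest projection `e ∈ M` with
`e h = h`. -/
def L1rangeProj (φ : L1 M) : Elem M :=
  projOnto (L1range φ) fun y hy v hv => by
    simp only [L1range, Submodule.mem_iInf] at hv ⊢
    intro e he
    have h1 := (isProj_apply he.1).1 (hv e he)
    have h2 := congrArg (fun T : H →L[ℂ] H => T v) (commutes_of_mem e hy)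
    refine (isProj_apply he.1).2 ?_
    change y ((e : H →L[ℂ] H) v) = (e : H →L[ℂ] H) (y v) at h2
    rw [← h2, h1]

theorem mem_leftUnits_toL1 (τ : L1 M) (hτ : IsTrace τ.1) (x e : Elem M) :
    e ∈ leftUnits (toL1 τ x) ↔ IsProj e ∧ e * x = x := by
  refine and_congr_right fun _ => ?_
  have key : ∀ z : Elem M, τ.1 (x * (z * e)) = τ.1 (e * x * z) := fun z => by
    rw [← mul_assoc, hτ.tracial, mul_assoc]
  constructor
  · intro h
    set w : Elem M := e * x - x with hw
    have h0 : τ.1 (w * star w) = 0 := by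
      have h1 : τ.1 (x * (star w * e)) = τ.1 (x * star w) := h (star w)
      rw [key] at h1
      rw [hw, sub_mul, map_sub, ← hw, h1, sub_self]
    have hpos : IsPos (w * star w) := by
      have := ContinuousLinearMap.isPositive_self_comp_adjoint (w : H →L[ℂ] H)
      exact this
    have h2 : w * star w = 0 := hτ.faithful _ hpos h0
    have h3 : (w : H →L[ℂ] H) * star (w : H →L[ℂ] H) = 0 := congrArg Subtype.val h2
    have h4 : (w : H →L[ℂ] H) = 0 := (CStarRing.mul_star_self_eq_zero_iff _).1 h3
    exact sub_eq_zero.1 (Subtype.ext h4)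
  · intro h z
    change τ.1 (x * (z * e)) = τ.1 (x * z)
    rw [key, h]

/-- On `M ⊆ L¹(M)` the two notions of range projection agree. -/
theorem L1rangeProj_toL1 (τ : L1 M) (hτ : IsTrace τ.1) (x : Elem M) :
    L1rangeProj (toL1 τ x) = rangeProj x := by
  refine Subtype.ext (Submodule.starProjection_inj.2 (le_antisymm ?_ ?_))
  · refine iInf₂_le_of_le (rangeProj x) ((mem_leftUnits_toL1 τ hτ x _).2 ⟨?_, ?_⟩) ?_
    · exact isStarProjection_starProjection
    · refine Subtype.ext (ContinuousLinearMap.ext fun v => ?_)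
      exact Submodule.starProjection_eq_self_iff.2
        (Submodule.le_topologicalClosure _ ⟨v, rfl⟩)
    · exact (Submodule.range_starProjection _).le
  · refine Submodule.topologicalClosure_minimal _ ?_ (isClosed_L1range _)
    rintro _ ⟨v, rfl⟩
    simp only [L1range, Submodule.mem_iInf]
    intro e he
    obtain ⟨he1, he2⟩ := (mem_leftUnits_toL1 τ hτ x e).1 he
    exact (isProj_apply he1).2
      (congrArg (fun T : Elem M => (T : H →L[ℂ] H) v) he2)

/-- `S(x) = τ (R(x))` for `x ∈ M`. -/
def S (τ : Elem M →ₗ[ℂ] ℂ) (x : Elem M) : ℝ := (τ (rangeProj x)).re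

/-- `S(h) = τ (R(h))` for `h ∈ L¹(M)`. -/
def L1S (τ : Elem M →ₗ[ℂ] ℂ) (h : L1 M) : ℝ := (τ (L1rangeProj h)).re

end Basic

/-! ### The spatial tensor product `M ⊗̄ M` -/

section Tensor

/-- The Hilbert space tensor product `H ⊗ H`. -/
abbrev HilbertTensor (H : Type u) [NormedAddCommGroup H] [InnerProductSpace ℂ H] : Type u :=
  UniformSpace.Completion (H ⊗[ℂ] H)

variable {H : Type u} [NormedAddCommGroup H] [InnerProductSpace ℂ H]

/-- The operator `a ⊗ b` on the Hilbert space tensor product, with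
`(a ⊗ b) (ξ ⊗ η) = a ξ ⊗ b η`. -/
def opTensor (a b : H →L[ℂ] H) : HilbertTensor H →L[ℂ] HilbertTensor H :=
  (UniformSpace.Completion.toComplL ∘L TensorProduct.mapL a b).extend
    (UniformSpace.Completion.toComplL (𝕜 := ℂ) (E := H ⊗[ℂ] H))

theorem opTensor_coe (a b : H →L[ℂ] H) (t : H ⊗[ℂ] H) :
    opTensor a b (t : HilbertTensor H) = (TensorProduct.mapL a b t : H ⊗[ℂ] H) :=
  ContinuousLinearMap.extend_eq _ (UniformSpace.Completion.denseRange_coe)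
    (UniformSpace.Completion.isUniformInducing_coe _) t

theorem opTensor_apply (a b : H →L[ℂ] H) (ξ η : H) :
    opTensor a b ((ξ ⊗ₜ[ℂ] η : H ⊗[ℂ] H) : HilbertTensor H) =
      ((a ξ ⊗ₜ[ℂ] b η : H ⊗[ℂ] H) : HilbertTensor H) := by
  rw [opTensor_coe, TensorProduct.mapL_tmul]

variable [CompleteSpace H]

/-- The commutant of the `*`-closed set of all operators `a ⊗ b`, `a, b ∈ M`. -/
def tensorCommutant (M : VonNeumannAlgebra H) :
    StarSubalgebra ℂ (HilbertTensor H →L[ℂ] HilbertTensor H) :=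
  StarSubalgebra.centralizer ℂ {t | ∃ a b : Elem M, t = opTensor a.1 b.1}

/-- The spatial tensor product `M ⊗̄ M`: the von Neumann algebra on `H ⊗ H` generated by the
operators `a ⊗ b`, `a, b ∈ M` (their double commutant). -/
def tensorSq (M : VonNeumannAlgebra H) : VonNeumannAlgebra (HilbertTensor H) where
  toStarSubalgebra := StarSubalgebra.centralizer ℂ
    (tensorCommutant M : Set (HilbertTensor H →L[ℂ] HilbertTensor H))
  centralizer_centralizer' := by
    have h := StarSubalgebra.coe_centralizer ℂ
      (tensorCommutant M : Set (HilbertTensor H →L[ℂ] HilbertTensor H))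
    exact (congrArg (fun t => Set.centralizer (Set.centralizer t)) h).trans
      ((Set.centralizer_centralizer_centralizer _).trans h.symm)

variable {M : VonNeumannAlgebra H}

/-- `a ⊗ b` as an element of `M ⊗̄ M`. -/
def tmul (a b : Elem M) : Elem (tensorSq M) :=
  ⟨opTensor a.1 b.1, by
    have h : opTensor a.1 b.1 ∈ StarSubalgebra.centralizer ℂ
        (tensorCommutant M : Set (HilbertTensor H →L[ℂ] HilbertTensor H)) := by
      rw [StarSubalgebra.mem_centralizer_iff]
      intro g hg
      have hg' : star g ∈ tensorCommutant M := star_mem hg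
      exact ⟨(((StarSubalgebra.mem_centralizer_iff ℂ).1 hg) _ ⟨a, b, rfl⟩).1.symm,
        (((StarSubalgebra.mem_centralizer_iff ℂ).1 hg') _ ⟨a, b, rfl⟩).1.symm⟩
    exact h⟩

/-- `T` is the product trace `τ ⊗ τ` on `M ⊗̄ M`, the trace with
`(τ ⊗ τ) (a ⊗ b) = τ (a) τ (b)`. -/
def IsProductTrace (τ : Elem M →ₗ[ℂ] ℂ) (T : Elem (tensorSq M) →ₗ[ℂ] ℂ) : Prop :=
  IsTrace T ∧ ∀ a b : Elem M, T (tmul a b) = τ a * τ b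

/-! ### Comultiplications and convolutions -/

/-- A `k`-comultiplication: a normal linear map `M → M ⊗̄ M` of operator norm `k`. -/
structure IsComultiplication (k : ℝ) (Δ : Elem M →L[ℂ] Elem (tensorSq M)) : Prop where
  normal : ∀ ψ : L1 (tensorSq M), IsNormal (ψ.1 ∘ₗ Δ.toLinearMap)
  norm_eq : ‖Δ‖ = k

/-- A good `k`-comultiplication: moreover `Δ ≥ 0` and `Δ(1) = k 1`. -/
structure IsGoodComultiplication (k : ℝ) (Δ : Elem M →L[ℂ] Elem (tensorSq M)) : Prop
    extends IsComultiplication k Δ where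
  pos : ∀ x : Elem M, IsPos x → IsPos (Δ x)
  map_one : Δ 1 = (k : ℂ) • 1

/-- The convolution `∗` is induced by the comultiplication `Δ`:
`⟨x ∗ y, z⟩ = ⟨x ⊗ y, Δ(z)⟩` for all `x, y, z ∈ M`, where `⟨a, b⟩ = τ (a b*)` on `M` and
`⟨a, b⟩ = (τ ⊗ τ) (a b*)` on `M ⊗̄ M`. -/
def IsInducedBy (τ : Elem M →ₗ[ℂ] ℂ) (conv : Elem M →ₗ[ℂ] Elem M →ₗ[ℂ] L1 M)
    (Δ : Elem M →L[ℂ] Elem (tensorSq M)) : Prop :=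
  ∃ T : Elem (tensorSq M) →ₗ[ℂ] ℂ, IsProductTrace τ T ∧
    ∀ x y z : Elem M, (conv x y).1 (star z) = T (tmul x y * star (Δ z))

/-- The three characteristic properties of a good `k`-convolution: positivity, the primary Young
inequality `‖x ∗ y‖₁ ≤ k ‖x‖₁ ‖y‖₁`, and the Haar measure property. The norm of `L¹(M)` is the
norm of linear functionals on `M`. -/
structure HasGoodProperties (τ : Elem M →ₗ[ℂ] ℂ) (k : ℝ)
    (conv : Elem M →ₗ[ℂ] Elem M →ₗ[ℂ] L1 M) : Prop where
  pos : ∀ x y : Elem M, IsPos x → IsPos y → L1IsPos (conv x y)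
  young : ∀ x y z : Elem M, ‖(conv x y).1 z‖ ≤ k * norm1 τ x * norm1 τ y * ‖z‖
  haar : ∀ x y : Elem M, L1trace (conv x y) = k * τ x * τ y

/-- A good `k`-convolution `∗ : M × M → L¹(M)`: it is induced by a good `k`-comultiplication, or,
more generally, it has the three characteristic properties above. -/
def IsGoodConvolution (τ : Elem M →ₗ[ℂ] ℂ) (k : ℝ)
    (conv : Elem M →ₗ[ℂ] Elem M →ₗ[ℂ] L1 M) : Prop :=
  (∃ Δ : Elem M →L[ℂ] Elem (tensorSq M), IsGoodComultiplication k Δ ∧ IsInducedBy τ conv Δ) ∨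
    HasGoodProperties τ k conv

/-- An antipode: a trace-preserving anti-`*`-isomorphism `ρ` of `M` satisfying the Frobenius
reciprocity `τ ((x ∗ y) z) = τ ((ρ(z) ∗ x) ρ(y))`. -/
structure IsAntipode (τ : Elem M →ₗ[ℂ] ℂ) (conv : Elem M →ₗ[ℂ] Elem M →ₗ[ℂ] L1 M)
    (ρ : Elem M ≃ₗ[ℂ] Elem M) : Prop where
  map_mul : ∀ x y : Elem M, ρ (x * y) = ρ y * ρ x
  map_star : ∀ x : Elem M, ρ (star x) = star (ρ x)
  trace_preserving : ∀ x : Elem M, τ (ρ x) = τ x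
  frobenius : ∀ x y z : Elem M, (conv x y).1 z = (conv (ρ z) x).1 (ρ y)

/-- `(M, τ, ∗, ρ)` is a Frobenius von Neumann `k`-algebra. -/
structure IsFNAlgebra (k : ℝ) (τ : Elem M →ₗ[ℂ] ℂ)
    (conv : Elem M →ₗ[ℂ] Elem M →ₗ[ℂ] L1 M) (ρ : Elem M ≃ₗ[ℂ] Elem M) : Prop where
  k_pos : 0 < k
  trace : IsTrace τ
  good : IsGoodConvolution τ k conv
  antipode : IsAntipode τ conv ρ

end Tensor

end FNAlg

end

/-!
Write `p = R(x)`, `q = R(y)`, `h = p ∗ q` and `e = R(h)`. The Haar property gives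
`h(1) = k τ(p) τ(q)`, and `h(1) = h(e)` because `e` is a left unit of `h`. Frobenius reciprocity
turns `h(e)` into `(ρ(e) ∗ p)(ρ(q))`, and, applied once more, into
`(ρ(ρ(q)) ∗ ρ(e))(ρ(p))`. Since a convolution of projections is a positive functional, replacing
`ρ(q)`, respectively `ρ(p)`, by `1` only increases these values; by the Haar property they are
at most `k τ(e) τ(p)` and `k τ(q) τ(e)`. Dividing by `k τ(p) > 0` and `k τ(q) > 0` gives
`τ(q) ≤ τ(e)` and `τ(p) ≤ τ(e)`.

Two points need work. The infimum of the left units of a normal functional has to be a left unit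
itself (`FNAlg.L1rangeProj_mem_leftUnits`); this holds because the left units of `h` are the
projections that fix a certain sequence of vectors
(`FNAlg.exists_forall_mem_leftUnits_iff`). And a convolution induced by a good comultiplication
has to be positive on projections and satisfy the Haar property
(`FNAlg.IsGoodConvolution.nonneg_of_isProj`, `FNAlg.IsGoodConvolution.haar`).
-/

open scoped TensorProduct ComplexOrder InnerProductSpace

namespace FNAlg

/-! ### Square-summable sequences of vectors -/

section SquareSummable

variable {H : Type*} [NormedAddCommGroup H]

/-- A square-summable sequence of vectors, as an element of `ℓ²(ℕ, H)`. -/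
def toLp2 (ξ : ℕ → H) (h : Summable fun n => ‖ξ n‖ ^ 2) : lp (fun _ : ℕ => H) 2 :=
  ⟨ξ, memℓp_gen (by simpa using h)⟩

theorem summable_norm_sq_lp (f : lp (fun _ : ℕ => H) 2) : Summable fun n => ‖f n‖ ^ 2 := by
  simpa using (lp.memℓp f).summable (by simp)

variable [InnerProductSpace ℂ H]

theorem summable_norm_sq_apply (a : H →L[ℂ] H) {ξ : ℕ → H} (h : Summable fun n => ‖ξ n‖ ^ 2) :
    Summable fun n => ‖a (ξ n)‖ ^ 2 := by
  refine Summable.of_nonneg_of_le (fun n => by positivity) (fun n => ?_)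
    (h.mul_left (‖a‖ ^ 2))
  rw [← mul_pow]
  gcongr
  exact a.le_opNorm _

end SquareSummable

/-! ### Projections and traces -/

section Basic

variable {H : Type*} [NormedAddCommGroup H] [InnerProductSpace ℂ H] [CompleteSpace H]
  {M : VonNeumannAlgebra H}

theorem isProj_iff {e : Elem M} : IsProj e ↔ IsStarProjection e := by
  refine ⟨fun h => ⟨Subtype.ext h.1, Subtype.ext h.2⟩, fun h => ⟨?_, ?_⟩⟩
  · exact congrArg Subtype.val h.1
  · exact congrArg Subtype.val h.2

theorem IsProj.isPos {e : Elem M} (he : IsProj e) : IsPos e :=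
  ContinuousLinearMap.IsPositive.of_isStarProjection he

theorem IsProj.one_sub {e : Elem M} (he : IsProj e) : IsProj (1 - e) :=
  isProj_iff.2 (isProj_iff.1 he).one_sub

theorem isProj_projOnto (K : Submodule ℂ H) [K.HasOrthogonalProjection]
    (hK : ∀ y ∈ M.commutant, ∀ v ∈ K, y v ∈ K) : IsProj (projOnto (M := M) K hK) :=
  isStarProjection_starProjection

theorem IsPos.conj {z : Elem M} (hz : IsPos z) {e : Elem M} (he : IsProj e) :
    IsPos (e * z * e) := by
  have h := ContinuousLinearMap.IsPositive.conj_adjoint hz (e : H →L[ℂ] H)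
  rw [← ContinuousLinearMap.star_eq_adjoint, he.isSelfAdjoint.star_eq] at h
  exact h

/-- By traciality, `τ (e z) = τ (e z e)` for a projection `e`. -/
theorem IsTrace.mul_nonneg {τ : Elem M →ₗ[ℂ] ℂ} (hτ : IsTrace τ) {e z : Elem M}
    (he : IsProj e) (hz : IsPos z) : 0 ≤ τ (e * z) := by
  have h : τ (e * z) = τ (e * z * e) := by
    rw [hτ.tracial (e * z) e, ← mul_assoc, (isProj_iff.1 he).isIdempotentElem.eq]
  exact h ▸ hτ.nonneg _ (hz.conj he)

theorem rangeProj_ne_zero {x : Elem M} (hx : x ≠ 0) : rangeProj x ≠ 0 := by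
  refine fun h => hx (Subtype.ext (ContinuousLinearMap.ext fun v => ?_))
  have h1 : (rangeProj x : H →L[ℂ] H) ((x : H →L[ℂ] H) v) = (x : H →L[ℂ] H) v :=
    Submodule.starProjection_eq_self_iff.2 (Submodule.le_topologicalClosure _ ⟨v, rfl⟩)
  rw [h] at h1
  exact h1.symm

theorem IsTrace.re_rangeProj_pos {τ : Elem M →ₗ[ℂ] ℂ} (hτ : IsTrace τ) {x : Elem M}
    (hx : x ≠ 0) : 0 < (τ (rangeProj x)).re := by
  have hp : IsPos (rangeProj x) := (isProj_projOnto _ _).isPos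
  have h0 : τ (rangeProj x) ≠ 0 := fun h => rangeProj_ne_zero hx (hτ.faithful _ hp h)
  exact (Complex.pos_iff.1 (lt_of_le_of_ne (hτ.nonneg _ hp) h0.symm)).1

/-! ### The range projection of a normal functional -/

/-- The orbit map `z ↦ (z ηₙ)ₙ` of `M` in `ℓ²(ℕ, H)`. -/
def orbitMap (M : VonNeumannAlgebra H) (η : ℕ → H) (h : Summable fun n => ‖η n‖ ^ 2) :
    Elem M →ₗ[ℂ] lp (fun _ : ℕ => H) 2 where
  toFun z := toLp2 (fun n => (z : H →L[ℂ] H) (η n)) (summable_norm_sq_apply _ h)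
  map_add' _ _ := rfl
  map_smul' _ _ := rfl

/-- The left units of a normal functional `φ = ∑ₙ ⟪ηₙ, · ξₙ⟫` are the projections that fix every
coordinate of `ξ'`, the orthogonal projection of `ξ = (ξₙ)ₙ` to the closed span of the orbit
`M η` in `ℓ²(ℕ, H)`. -/
theorem exists_forall_mem_leftUnits_iff (φ : L1 M) :
    ∃ ξ' : ℕ → H, ∀ e : Elem M, IsProj e →
      (e ∈ leftUnits φ ↔ ∀ n, (e : H →L[ℂ] H) (ξ' n) = ξ' n) := by
  obtain ⟨ξ, η, hξ, hη, hφ⟩ := φ.2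
  let K : Submodule ℂ (lp (fun _ : ℕ => H) 2) :=
    (LinearMap.range (orbitMap M η hη)).topologicalClosure
  have hmem : ∀ z : Elem M, orbitMap M η hη z ∈ K :=
    fun z => Submodule.le_topologicalClosure _ ⟨z, rfl⟩
  have hcomplete : CompleteSpace K :=
    (Submodule.isClosed_topologicalClosure _).completeSpace_coe
  obtain ⟨ξ', hξ', ξ'', hξ'', hsum⟩ := K.exists_add_mem_mem_orthogonal (toLp2 ξ hξ)
  have hn : ∀ n, ξ n = ξ' n + ξ'' n := fun n =>
    congrArg (fun f : lp (fun _ : ℕ => H) 2 => f n) hsum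
  have hstar : ∀ (a : H →L[ℂ] H) (u v : H), ⟪u, a v⟫_ℂ = ⟪star a u, v⟫_ℂ := fun a u v => by
    rw [ContinuousLinearMap.star_eq_adjoint, ContinuousLinearMap.adjoint_inner_left]
  -- Since `M η` is `M`-invariant, `ξ` may be replaced by `ξ'` in the formula for `φ`.
  have key : ∀ z f : Elem M, φ.1 (z * f) = ⟪orbitMap M η hη (star z),
      toLp2 (fun n => (f : H →L[ℂ] H) (ξ' n))
        (summable_norm_sq_apply _ (summable_norm_sq_lp ξ'))⟫_ℂ := by
    intro z f
    have h1 := lp.hasSum_inner (𝕜 := ℂ) (orbitMap M η hη (star z))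
      (toLp2 (fun n => (f : H →L[ℂ] H) (ξ' n))
        (summable_norm_sq_apply _ (summable_norm_sq_lp ξ')))
    have h2 := lp.hasSum_inner (𝕜 := ℂ) (orbitMap M η hη (star (z * f))) ξ''
    rw [Submodule.inner_right_of_mem_orthogonal (hmem _) hξ''] at h2
    have h3 := h1.add h2
    rw [add_zero] at h3
    refine (hφ (z * f)).unique (h3.congr_fun fun n => ?_)
    change ⟪η n, (z : H →L[ℂ] H) ((f : H →L[ℂ] H) (ξ n))⟫_ℂ =
      ⟪star (z : H →L[ℂ] H) (η n), (f : H →L[ℂ] H) (ξ' n)⟫_ℂ +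
        ⟪star ((z : H →L[ℂ] H) * (f : H →L[ℂ] H)) (η n), ξ'' n⟫_ℂ
    rw [hn n, map_add, map_add, inner_add_right, ← hstar, ← hstar]
    rfl
  refine ⟨fun n => ξ' n, fun e he => ⟨fun hu n => ?_, fun hu => ⟨he, fun z => ?_⟩⟩⟩
  · set w : lp (fun _ : ℕ => H) 2 := toLp2 (fun n => ((1 - e : Elem M) : H →L[ℂ] H) (ξ' n))
      (summable_norm_sq_apply _ (summable_norm_sq_lp ξ')) with hw
    have hwK : w ∈ Kᗮ := by
      change w ∈ ((LinearMap.range (orbitMap M η hη)).topologicalClosure)ᗮ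
      rw [Submodule.orthogonal_closure, Submodule.mem_orthogonal]
      rintro _ ⟨z, rfl⟩
      have := key (star z) (1 - e)
      rw [star_star] at this
      rw [← this, mul_sub, mul_one, map_sub, hu.2, sub_self]
    -- `⟪w, w⟫ = ⟪ξ', w⟫` as `1 - e` is a projection, and `ξ' ∈ K` while `w ∈ Kᗮ`.
    have hww : ⟪w, w⟫_ℂ = ⟪ξ', w⟫_ℂ := by
      rw [lp.inner_eq_tsum, lp.inner_eq_tsum]
      refine tsum_congr fun n => ?_
      have hp : IsStarProjection ((1 - e : Elem M) : H →L[ℂ] H) := he.one_sub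
      change ⟪((1 - e : Elem M) : H →L[ℂ] H) (ξ' n), ((1 - e : Elem M) : H →L[ℂ] H) (ξ' n)⟫_ℂ =
        ⟪ξ' n, ((1 - e : Elem M) : H →L[ℂ] H) (ξ' n)⟫_ℂ
      rw [hstar, hp.isSelfAdjoint.star_eq, ← mul_apply_eq_comp,
        hp.isIdempotentElem.eq, hstar, hp.isSelfAdjoint.star_eq]
    rw [Submodule.inner_right_of_mem_orthogonal hξ' hwK, inner_self_eq_zero] at hww
    have h0 : ξ' n - (e : H →L[ℂ] H) (ξ' n) = 0 :=
      congrArg (fun f : lp (fun _ : ℕ => H) 2 => f n) hww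
    exact (sub_eq_zero.1 h0).symm
  · have h1 := key z 1
    rw [mul_one] at h1
    rw [key, h1]
    congr 1
    exact Subtype.ext (funext hu)

/-- The range projection of `h ∈ L¹(M)` is itself a left unit of `h`. -/
theorem L1rangeProj_mem_leftUnits (φ : L1 M) : L1rangeProj φ ∈ leftUnits φ := by
  obtain ⟨ξ', h⟩ := exists_forall_mem_leftUnits_iff φ
  refine (h _ (isProj_projOnto _ _)).2 fun n => Submodule.starProjection_eq_self_iff.2 ?_
  simp only [L1range, Submodule.mem_iInf]
  exact fun e he => (isProj_apply he.1).2 ((h e he.1).1 he n)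

end Basic

/-! ### Convolutions of projections -/

section Tensor

variable {H : Type*} [NormedAddCommGroup H] [InnerProductSpace ℂ H]

theorem ext_hilbertTensor {A B : HilbertTensor H →L[ℂ] HilbertTensor H}
    (h : ∀ ξ η : H, A ((ξ ⊗ₜ[ℂ] η : H ⊗[ℂ] H) : HilbertTensor H) =
      B ((ξ ⊗ₜ[ℂ] η : H ⊗[ℂ] H) : HilbertTensor H)) : A = B := by
  refine ContinuousLinearMap.ext fun v => ?_
  induction v using UniformSpace.Completion.induction_on with
  | hp => exact isClosed_eq A.continuous B.continuous
  | ih t =>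
    induction t using TensorProduct.induction_on with
    | zero => rw [UniformSpace.Completion.coe_zero, map_zero, map_zero]
    | tmul ξ η => exact h ξ η
    | add s t hs ht => rw [UniformSpace.Completion.coe_add, map_add, map_add, hs, ht]

theorem opTensor_mul (a b c d : H →L[ℂ] H) :
    opTensor a b * opTensor c d = opTensor (a * c) (b * d) :=
  ext_hilbertTensor fun ξ η => by
    simp only [mul_apply_eq_comp, opTensor_apply]

variable [CompleteSpace H]

theorem star_opTensor (a b : H →L[ℂ] H) :
    star (opTensor a b) = opTensor (star a) (star b) := by
  rw [ContinuousLinearMap.star_eq_adjoint]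
  refine ((ContinuousLinearMap.eq_adjoint_iff _ _).2 fun v w => ?_).symm
  induction v, w using UniformSpace.Completion.induction_on₂ with
  | hp => exact isClosed_eq (by fun_prop) (by fun_prop)
  | ih s t =>
    rw [opTensor_coe, opTensor_coe, UniformSpace.Completion.inner_coe,
      UniformSpace.Completion.inner_coe]
    induction s using TensorProduct.induction_on with
    | zero => simp
    | add s s' hs hs' => rw [map_add, inner_add_left, inner_add_left, hs, hs']
    | tmul ξ η =>
      induction t using TensorProduct.induction_on with
      | zero => simp
      | add t t' ht ht' => rw [map_add, inner_add_right, inner_add_right, ht, ht']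
      | tmul ξ' η' =>
        simp [ContinuousLinearMap.star_eq_adjoint,
          ContinuousLinearMap.adjoint_inner_left]

variable {M : VonNeumannAlgebra H}

theorem isProj_tmul {p q : Elem M} (hp : IsProj p) (hq : IsProj q) : IsProj (tmul p q) := by
  refine ⟨?_, ?_⟩
  · change opTensor p.1 q.1 * opTensor p.1 q.1 = opTensor p.1 q.1
    rw [opTensor_mul, hp.isIdempotentElem.eq, hq.isIdempotentElem.eq]
  · change star (opTensor p.1 q.1) = opTensor p.1 q.1
    rw [star_opTensor, hp.isSelfAdjoint.star_eq, hq.isSelfAdjoint.star_eq]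

theorem IsPos.star_eq {z : Elem M} (hz : IsPos z) : star z = z :=
  Subtype.ext hz.isSelfAdjoint.star_eq

variable {τ : Elem M →ₗ[ℂ] ℂ} {k : ℝ} {conv : Elem M →ₗ[ℂ] Elem M →ₗ[ℂ] L1 M}

/-- In the induced case, `(p ∗ q)(z) = (τ ⊗ τ)((p ⊗ q) Δ(z))`, and `p ⊗ q` is a projection. -/
theorem IsGoodConvolution.nonneg_of_isProj (h : IsGoodConvolution τ k conv) {p q : Elem M}
    (hp : IsProj p) (hq : IsProj q) : L1IsPos (conv p q) := by
  rcases h with ⟨Δ, hΔ, T, hT, hconv⟩ | h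
  · intro z hz
    have h1 := hconv p q z
    rw [hz.star_eq, (hΔ.pos z hz).star_eq] at h1
    rw [h1]
    exact hT.1.mul_nonneg (isProj_tmul hp hq) (hΔ.pos z hz)
  · exact h.pos p q hp.isPos hq.isPos

theorem IsGoodConvolution.haar (h : IsGoodConvolution τ k conv) (x y : Elem M) :
    (conv x y).1 1 = k * τ x * τ y := by
  rcases h with ⟨Δ, hΔ, T, hT, hconv⟩ | h
  · have h1 := hconv x y 1
    rw [star_one, hΔ.map_one, star_smul, star_one, mul_smul_comm, mul_one, map_smul,
      hT.2] at h1
    rw [h1, Complex.star_def, Complex.conj_ofReal, smul_eq_mul, mul_assoc]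
  · exact h.haar x y

/-- A convolution of two projections takes at a projection at most its value at `1`. -/
theorem IsGoodConvolution.apply_le (h : IsGoodConvolution τ k conv) {p q r : Elem M}
    (hp : IsProj p) (hq : IsProj q) (hr : IsProj r) :
    (conv p q).1 r ≤ k * τ p * τ q := by
  have h1 := h.nonneg_of_isProj hp hq (1 - r) hr.one_sub.isPos
  rwa [map_sub, sub_nonneg, h.haar] at h1

theorem IsAntipode.isProj {ρ : Elem M ≃ₗ[ℂ] Elem M} (hρ : IsAntipode τ conv ρ) {e : Elem M}
    (he : IsProj e) : IsProj (ρ e) := by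
  have he' := isProj_iff.1 he
  refine isProj_iff.2 ⟨?_, ?_⟩
  · change ρ e * ρ e = ρ e
    rw [← hρ.map_mul, he'.isIdempotentElem.eq]
  · change star (ρ e) = ρ e
    rw [← hρ.map_star, he'.isSelfAdjoint.star_eq]

end Tensor

end FNAlg

theorem theorem3p17 {H : Type*} [NormedAddCommGroup H] [InnerProductSpace ℂ H] [CompleteSpace H]
    (M : VonNeumannAlgebra H) (k : ℝ) (τ : FNAlg.Elem M →ₗ[ℂ] ℂ)
    (conv : FNAlg.Elem M →ₗ[ℂ] FNAlg.Elem M →ₗ[ℂ] FNAlg.L1 M)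
    (ρ : FNAlg.Elem M ≃ₗ[ℂ] FNAlg.Elem M)
    (hFN : FNAlg.IsFNAlgebra k τ conv ρ)
    (x y : FNAlg.Elem M) (hx : x ≠ 0) (hy : y ≠ 0) :
    max (FNAlg.S τ x) (FNAlg.S τ y) ≤
      FNAlg.L1S τ (conv (FNAlg.rangeProj x) (FNAlg.rangeProj y)) := by
  obtain ⟨hk, hτ, hgood, hρ⟩ := hFN
  have hp0 := hτ.re_rangeProj_pos hx
  have hq0 := hτ.re_rangeProj_pos hy
  have hunit := (FNAlg.L1rangeProj_mem_leftUnits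
    (conv (FNAlg.rangeProj x) (FNAlg.rangeProj y))).2 1
  unfold FNAlg.S FNAlg.L1S
  have hp : FNAlg.IsProj (FNAlg.rangeProj x) := FNAlg.isProj_projOnto _ _
  have hq : FNAlg.IsProj (FNAlg.rangeProj y) := FNAlg.isProj_projOnto _ _
  have he : FNAlg.IsProj (FNAlg.L1rangeProj (conv (FNAlg.rangeProj x) (FNAlg.rangeProj y))) :=
    FNAlg.isProj_projOnto _ _
  generalize FNAlg.L1rangeProj (conv (FNAlg.rangeProj x) (FNAlg.rangeProj y)) = e at *
  generalize FNAlg.rangeProj x = p at *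
  generalize FNAlg.rangeProj y = q at *
  rw [one_mul, hgood.haar, hρ.frobenius] at hunit
  have h1 := hgood.apply_le (hρ.isProj he) hp (hρ.isProj hq)
  have h2 := hgood.apply_le (hρ.isProj (hρ.isProj hq)) (hρ.isProj he) (hρ.isProj hp)
  rw [← hρ.frobenius, hunit] at h2
  rw [hunit] at h1
  simp only [hρ.trace_preserving] at h1 h2
  -- The values of `τ` at projections are real, so the inequalities may be read in `ℝ`.
  have hreal : ∀ {f : FNAlg.Elem M}, FNAlg.IsProj f → τ f = ((τ f).re : ℂ) := fun hf =>
    Complex.ext rfl (Complex.nonneg_iff.1 (hτ.nonneg _ hf.isPos)).2.symm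
  rw [hreal hp, hreal hq, hreal he] at h1 h2
  norm_cast at h1 h2
  refine max_le ?_ ?_
  · have h3 : k * (τ q).re * (τ p).re ≤ k * (τ q).re * (τ e).re := by linarith
    exact le_of_mul_le_mul_left h3 (mul_pos hk hq0)
  · have h3 : k * (τ p).re * (τ q).re ≤ k * (τ p).re * (τ e).re := by linarith
    exact le_of_mul_le_mul_left h3 (mul_pos hk hp0)
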